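/- There are absolute constants $\bar c>0$ and $c\ge 1$ for which the following holds. Let $1\le k\le n$ be integers and $0<\theta<1$. Let $\mu$ be a probability measure on $\mathbb{R}^n$ that is isotropic, i.e. $\mathbb{E}\langle X,y\rangle^2=|y|^2$ for all $y\in\mathbb{R}^n$ when $X$ is distributed according to $\mu$, and that satisfies a $\psi_2$ condition with constant $\alpha$, i.e. $\|\langle X,y\rangle\|_{\psi_2}\le\alpha|y|$ for all $y\in\mathbb{R}^n$, where $|\cdot|$ is the Euclidean norm and $\|Y\|_{\psi_2}=\inf\{u>0:\mathbb{E}\exp(Y^2/u^2)\le 2\}$. Let $X_1,\dots,X_k$ be independent random vectors distributed according to $\mu$. For $0<p<1$ let $B_{p,\infty}^n$ be the set of all $x\in\mathbb{R}^n$ with $|\{i:|x_i|\ge s\}|\le s^{-p}$ for all $s>0$, let $B_1^n$ be the set of all $x\in\mathbb{R}^n$ with $\sum_{i=1}^n|x_i|\le 1$, and put $C_{\alpha,\theta}=c\,\alpha^4/\theta^2$. Then, with probability at least $1-\exp(-\bar c\,\theta^2k/\alpha^4)$, the following two assertions hold for every $\varepsilon>0$. (i) For every $0<p<1$, if $v,y\in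 B_{p,\infty}^n$ satisfy $\bigl(\frac1k\sum_{i=1}^k\langle X_i,v-y\rangle^2\bigr)^{1/2}\le\varepsilon$, then $$|y-v|\le\frac{\varepsilon}{1-\theta}+2^{1/p+1}\Bigl(\frac1p-1\Bigr)^{-1}\Bigl(C_{\alpha,\theta}\,\frac{\log(C_{\alpha,\theta}n/k)}{k}\Bigr)^{1/p-1/2}.$$ (ii) If $v,y\in B_1^n$ satisfy $\bigl(\frac1k\sum_{i=1}^k\langle X_i,v-y\rangle^2\bigr)^{1/2}\le\varepsilon$, then $$|y-v|\le\frac{\varepsilon}{1-\theta}+\Bigl(C_{\alpha,\theta}\,\frac{\log(C_{\alpha,\theta}n/k)}{k}\Bigr)^{1/2}.$$ -/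

import Mathlib

open MeasureTheory ProbabilityTheory
open scoped ENNReal

noncomputable section

/-- The `ψ₂` norm `inf {u > 0 : 𝔼 exp (Y² / u²) ≤ 2}` of a random variable `Y`, with values in
`[0, ∞]` (it is `∞` if no such `u` exists). -/
def psi2Norm {Ω : Type*} [MeasurableSpace Ω] (Y : Ω → ℝ) (P : Measure Ω) : ℝ≥0∞ :=
  ⨅ (u : ℝ) (_ : 0 < u ∧ ∫⁻ ω, ENNReal.ofReal (Real.exp (Y ω ^ 2 / u ^ 2)) ∂P ≤ 2),
    ENNReal.ofReal u

/-- A measure on `ℝⁿ` is isotropic if `𝔼 ⟨X, y⟩² = |y|²` for every `y`. (For `y ≠ 0` the right-hand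
side is nonzero, so the equation forces integrability of the integrand.) -/
def IsIsotropic {n : ℕ} (μ : Measure (EuclideanSpace ℝ (Fin n))) : Prop :=
  ∀ y : EuclideanSpace ℝ (Fin n), ∫ x, (inner ℝ x y) ^ 2 ∂μ = ‖y‖ ^ 2

/-- A measure on `ℝⁿ` satisfies a `ψ₂` condition with constant `α` if
`‖⟨X, y⟩‖_{ψ₂} ≤ α |y|` for every `y`. -/
def IsPsi2With {n : ℕ} (μ : Measure (EuclideanSpace ℝ (Fin n))) (α : ℝ) : Prop :=
  ∀ y : EuclideanSpace ℝ (Fin n),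
    psi2Norm (fun x : EuclideanSpace ℝ (Fin n) => inner ℝ x y) μ ≤ ENNReal.ofReal (α * ‖y‖)

/-- The unit ball `B_{p,∞}^n` of the weak `ℓ_p^n` space: all `x ∈ ℝⁿ` with
`|{i : |x_i| ≥ s}| ≤ s^{-p}` for every `s > 0`. -/
def weakLpBall (n : ℕ) (p : ℝ) : Set (EuclideanSpace ℝ (Fin n)) :=
  {x | ∀ s : ℝ, 0 < s → (Set.ncard {i : Fin n | s ≤ |x i|} : ℝ) ≤ s ^ (-p)}

/-- The unit ball `B_1^n` of `ℓ_1^n`. -/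
def l1Ball (n : ℕ) : Set (EuclideanSpace ℝ (Fin n)) :=
  {x | ∑ i, |x i| ≤ 1}

/-- The empirical quantity `((1/k) ∑ ⟨X_i, z⟩²)^{1/2}` for a sample `x_1, …, x_k` in `ℝⁿ`. -/
def empiricalNorm {n k : ℕ} (x : Fin k → EuclideanSpace ℝ (Fin n))
    (z : EuclideanSpace ℝ (Fin n)) : ℝ :=
  Real.sqrt ((∑ i, (inner ℝ (x i) z) ^ 2) / (k : ℝ))

/-- The quantity `C_{α,θ} log (C_{α,θ} n / k) / k`, where `C_{α,θ} = c α⁴ / θ²`. -/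
def rateTerm (c α θ : ℝ) (n k : ℕ) : ℝ :=
  (c * α ^ 4 / θ ^ 2) * Real.log ((c * α ^ 4 / θ ^ 2) * (n : ℝ) / (k : ℝ)) / (k : ℝ)

end

/-! Put `z = v - y` and let `ρ` be the rate term. If `‖z‖` exceeds the claimed error radius, then
`‖z‖₁ ≤ √(20/ρ) ‖z‖` (`sum_abs_le_of_weakLp_of_lt_norm`, `sum_abs_le_of_l1_of_lt_norm`). So it
suffices that, with high probability, `(1 - θ) ‖z‖` is at most the empirical norm for all such `z`
at once.

This is reduced to finitely many vectors by Maurey's method. If `‖z‖₁ ≤ 1`, then `z` is the mean of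
a random `ξ` in `{0, ± e_i}`, and for a quadratic form `B` and `m` independent copies, `𝔼 B(ξ₁ + ⋯ +
ξ_m) = m² B(z) + m (𝔼 B(ξ) - B(z))`. If `B ≥ 0` on all `m`-fold sums and `B(± e_i) ≤ κ`, it follows
that `B(z) ≥ -κ / (m - 1)`. Take `B` to be the squared empirical norm minus `(1 - θ/2) ‖·‖²`, with
`κ = θ` and `m` about `40/ρ`; scaling then gives `empiricalNorm_lower_bound`.

The `m`-fold sums are controlled by Bernstein's inequality (`measure_abs_mean_sq_sub_one_ge_le`) and
a union bound. The choice of `ρ` makes the logarithm of the number of sums a small multiple of `θ² k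
/ α⁴` (`two_mul_card_sym_le_exp`). If `ρ ≥ 4`, the asserted bounds hold deterministically. -/

/-! ### Maurey's method and the lower bound for the empirical norm -/

/-- One step of Maurey's empirical method: averaging a quadratic form over a random shift. -/
theorem sum_weights_bilin_add {V ι : Type*} [AddCommGroup V] [Module ℝ V] [Fintype ι]
    (B : V →ₗ[ℝ] V →ₗ[ℝ] ℝ) (w : ι → ℝ) (ξ : ι → V) (u z : V)
    (hw1 : ∑ i, w i = 1) (hz : ∑ i, w i • ξ i = z) :
    ∑ i, w i * B (u + ξ i) (u + ξ i) =
      B (u + z) (u + z) + (∑ i, w i * B (ξ i) (ξ i) - B z z) := by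
  have h1 : ∑ i, w i * B u (ξ i) = B u z := by
    rw [← hz, map_sum]; simp
  have h2 : ∑ i, w i * B (ξ i) u = B z u := by
    rw [← hz, map_sum, LinearMap.sum_apply]; simp
  have h3 : ∑ i, w i * B u u = B u u := by rw [← Finset.sum_mul, hw1, one_mul]
  simp only [map_add, LinearMap.add_apply, mul_add, Finset.sum_add_distrib]
  rw [h1, h2, h3]; ring

/-- Maurey's empirical method for a quadratic form which is nonnegative on `m`-fold sums. -/
theorem bilin_nonneg_of_multiset_sums {V ι : Type*} [AddCommGroup V] [Module ℝ V] [Fintype ι]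
    (B : V →ₗ[ℝ] V →ₗ[ℝ] ℝ) (w : ι → ℝ) (ξ : ι → V) (z : V) (hw : ∀ i, 0 ≤ w i)
    (hw1 : ∑ i, w i = 1) (hz : ∑ i, w i • ξ i = z) (m : ℕ) :
    ∀ u : V, (∀ s : Multiset ι, Multiset.card s = m →
      0 ≤ B (u + (s.map ξ).sum) (u + (s.map ξ).sum)) →
      0 ≤ B (u + (m : ℝ) • z) (u + (m : ℝ) • z) +
        m * (∑ i, w i * B (ξ i) (ξ i) - B z z) := by
  induction m with
  | zero =>
    intro u h
    have := h 0 rfl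
    simpa using this
  | succ m ih =>
    intro u h
    -- Condition on one draw `ξ i` and absorb it into the shift; this is why the induction runs over
    -- all `u`.
    have key : ∀ i, 0 ≤ B (u + ξ i + (m : ℝ) • z) (u + ξ i + (m : ℝ) • z) +
        m * (∑ i, w i * B (ξ i) (ξ i) - B z z) := by
      intro i
      refine ih (u + ξ i) fun s hs => ?_
      have := h (i ::ₘ s) (by simp [hs])
      simpa [add_assoc] using this
    have hsum : 0 ≤ ∑ i, w i * (B (u + ξ i + (m : ℝ) • z) (u + ξ i + (m : ℝ) • z) +
        m * (∑ i, w i * B (ξ i) (ξ i) - B z z)) :=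
      Finset.sum_nonneg fun i _ => mul_nonneg (hw i) (key i)
    simp only [mul_add, Finset.sum_add_distrib] at hsum
    rw [← Finset.sum_mul (f := w), hw1, one_mul] at hsum
    have hstep := sum_weights_bilin_add B w ξ (u + (m : ℝ) • z) z hw1 hz
    have e1 : ∀ i, u + ξ i + (m : ℝ) • z = u + (m : ℝ) • z + ξ i := fun i => by abel
    simp only [e1] at hsum
    rw [hstep] at hsum
    have e2 : u + ((m + 1 : ℕ) : ℝ) • z = u + (m : ℝ) • z + z := by
      push_cast; rw [add_smul, one_smul, add_assoc]
    rw [e2]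
    push_cast
    linarith

/-- The vectors `0` and `± e_i`. -/
noncomputable def signedBasis (n : ℕ) : Option (Fin n × Bool) → EuclideanSpace ℝ (Fin n)
  | none => 0
  | some (i, true) => EuclideanSpace.single i 1
  | some (i, false) => -EuclideanSpace.single i 1

theorem bilin_lower_bound_of_l1_le_one {n m : ℕ} (hm : 2 ≤ m)
    (B : EuclideanSpace ℝ (Fin n) →ₗ[ℝ] EuclideanSpace ℝ (Fin n) →ₗ[ℝ] ℝ) {κ : ℝ} (hκ : 0 ≤ κ)
    (hB : ∀ s : Multiset (Option (Fin n × Bool)), Multiset.card s = m →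
      0 ≤ B (s.map (signedBasis n)).sum (s.map (signedBasis n)).sum)
    (hdiag : ∀ i, B (EuclideanSpace.single i 1) (EuclideanSpace.single i 1) ≤ κ)
    (z : EuclideanSpace ℝ (Fin n)) (hz : ∑ i, |z i| ≤ 1) :
    -(κ / (m - 1)) ≤ B z z := by
  classical
  -- The positive and negative parts of the coordinates weight `± e_i`; the vector `0` takes the
  -- leftover mass `1 - ‖z‖₁`.
  let w : Option (Fin n × Bool) → ℝ := fun o => match o with
    | none => 1 - ∑ i, |z i|
    | some (i, true) => max (z i) 0
    | some (i, false) => max (-z i) 0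
  have habs : ∀ x : ℝ, max x 0 + max (-x) 0 = |x| := fun x => by
    rcases le_total 0 x with h | h
    · rw [max_eq_left h, max_eq_right (by linarith), abs_of_nonneg h, add_zero]
    · rw [max_eq_right h, max_eq_left (by linarith), abs_of_nonpos h, zero_add]
  have hdif : ∀ x : ℝ, max x 0 - max (-x) 0 = x := fun x => by
    rcases le_total 0 x with h | h
    · rw [max_eq_left h, max_eq_right (by linarith), sub_zero]
    · rw [max_eq_right h, max_eq_left (by linarith)]; ring
  have hw : ∀ o, 0 ≤ w o := by
    rintro (_ | ⟨i, _ | _⟩)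
    · simpa [w] using hz
    · exact le_max_right _ _
    · exact le_max_right _ _
  have hw1 : ∑ o, w o = 1 := by
    rw [Fintype.sum_option, Fintype.sum_prod_type]
    simp [w, habs]
  have hwz : ∑ o, w o • signedBasis n o = z := by
    rw [Fintype.sum_option, Fintype.sum_prod_type]
    simp only [Fintype.univ_bool, Finset.mem_singleton, Bool.true_eq_false, not_false_eq_true,
      Finset.sum_insert, Finset.sum_singleton, w, signedBasis, smul_zero, zero_add, smul_neg,
      ← sub_eq_add_neg, ← sub_smul, hdif]
    ext j
    simp [Finset.sum_apply, Pi.single_apply]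
  have hwB : ∑ o, w o * B (signedBasis n o) (signedBasis n o) ≤ κ := by
    calc ∑ o, w o * B (signedBasis n o) (signedBasis n o) ≤ ∑ o, w o * κ := by
          refine Finset.sum_le_sum fun o _ => mul_le_mul_of_nonneg_left ?_ (hw o)
          rcases o with _ | ⟨i, _ | _⟩
          · simpa [signedBasis] using hκ
          · simpa [signedBasis] using hdiag i
          · exact hdiag i
      _ = κ := by rw [← Finset.sum_mul, hw1, one_mul]
  have hmain := bilin_nonneg_of_multiset_sums B w (signedBasis n) z hw hw1 hwz m 0
    (fun s hs => by simpa using hB s hs)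
  simp only [zero_add, map_smul, LinearMap.smul_apply, smul_eq_mul] at hmain
  have hm' : (2 : ℝ) ≤ m := by exact_mod_cast hm
  rw [neg_le_iff_add_nonneg, ← sub_nonneg]
  have h1 : 0 ≤ m * ((m - 1) * B z z + κ) := by nlinarith
  have h2 : 0 ≤ (m - 1) * B z z + κ := nonneg_of_mul_nonneg_right h1 (by linarith)
  have h3 : B z z + κ / (m - 1) = ((m - 1) * B z z + κ) / (m - 1) := by
    field_simp [show (m : ℝ) - 1 ≠ 0 by linarith]
  rw [sub_zero, h3]
  exact div_nonneg h2 (by linarith)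

theorem bilin_lower_bound_of_l1_le {n m : ℕ} (hm : 2 ≤ m)
    (B : EuclideanSpace ℝ (Fin n) →ₗ[ℝ] EuclideanSpace ℝ (Fin n) →ₗ[ℝ] ℝ) {κ L : ℝ} (hκ : 0 ≤ κ)
    (hB : ∀ s : Multiset (Option (Fin n × Bool)), Multiset.card s = m →
      0 ≤ B (s.map (signedBasis n)).sum (s.map (signedBasis n)).sum)
    (hdiag : ∀ i, B (EuclideanSpace.single i 1) (EuclideanSpace.single i 1) ≤ κ) (hL : 0 < L)
    (z : EuclideanSpace ℝ (Fin n)) (hz : ∑ i, |z i| ≤ L) :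
    -(κ * L ^ 2 / (m - 1)) ≤ B z z := by
  have h := bilin_lower_bound_of_l1_le_one hm B hκ hB hdiag (L⁻¹ • z) (by
    simp only [PiLp.smul_apply, smul_eq_mul, abs_mul, ← Finset.mul_sum, abs_inv, abs_of_pos hL]
    rw [inv_mul_le_iff₀ hL]; simpa using hz)
  simp only [map_smul, LinearMap.smul_apply, smul_eq_mul] at h
  have h' := mul_le_mul_of_nonneg_left h (sq_nonneg L)
  have e1 : L ^ 2 * (L⁻¹ * (L⁻¹ * B z z)) = B z z := by field_simp
  rw [e1] at h'
  calc _ = L ^ 2 * -(κ / (m - 1)) := by ring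
    _ ≤ _ := h'

/-- The bilinear form `(1/k) ∑ ⟨x_i, u⟩⟨x_i, v⟩ - a ⟨u, v⟩`. -/
noncomputable def empiricalForm {n k : ℕ} (x : Fin k → EuclideanSpace ℝ (Fin n)) (a : ℝ) :
    EuclideanSpace ℝ (Fin n) →ₗ[ℝ] EuclideanSpace ℝ (Fin n) →ₗ[ℝ] ℝ :=
  LinearMap.mk₂ ℝ (fun u v => (∑ i, inner ℝ (x i) u * inner ℝ (x i) v) / (k : ℝ) - a * inner ℝ u v)
    (fun u u' v => by simp only [inner_add_right, inner_add_left, add_mul, Finset.sum_add_distrib]; ring)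
    (fun c u v => by
      simp only [inner_smul_right, real_inner_smul_left, mul_assoc, ← Finset.mul_sum, smul_eq_mul]
      ring)
    (fun u v v' => by simp only [inner_add_right, mul_add, Finset.sum_add_distrib]; ring)
    (fun c u v => by
      simp only [inner_smul_right, mul_left_comm _ c, ← Finset.mul_sum, smul_eq_mul]
      ring)

theorem empiricalForm_self {n k : ℕ} (x : Fin k → EuclideanSpace ℝ (Fin n)) (a : ℝ)
    (z : EuclideanSpace ℝ (Fin n)) :
    empiricalForm x a z z = empiricalNorm x z ^ 2 - a * ‖z‖ ^ 2 := by
  rw [empiricalNorm, Real.sq_sqrt (by positivity)]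
  simp [empiricalForm, pow_two]

/-- If the empirical norm almost preserves the norm of all `m`-fold sums of signed basis vectors,
it is bounded below on vectors with a small ratio of `ℓ₁` and Euclidean norms. -/
theorem empiricalNorm_lower_bound {n k m : ℕ} (hm : 2 ≤ m)
    (x : Fin k → EuclideanSpace ℝ (Fin n)) {θ L : ℝ} (hθ : 0 < θ) (hθ1 : θ < 1)
    (hx : ∀ s : Multiset (Option (Fin n × Bool)), Multiset.card s = m →
      |empiricalNorm x (s.map (signedBasis n)).sum ^ 2 - ‖(s.map (signedBasis n)).sum‖ ^ 2| ≤
        θ / 2 * ‖(s.map (signedBasis n)).sum‖ ^ 2)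
    (hL : 0 < L) (hLm : 2 * L ^ 2 ≤ m - 1) (z : EuclideanSpace ℝ (Fin n))
    (hz : ∑ i, |z i| ≤ L * ‖z‖) :
    (1 - θ) * ‖z‖ ≤ empiricalNorm x z := by
  have hm' : (2 : ℝ) ≤ m := by exact_mod_cast hm
  rcases eq_or_ne z 0 with rfl | hz0
  · simp [empiricalNorm]
  have hzpos : 0 < ‖z‖ := norm_pos_iff.2 hz0
  have hlow := bilin_lower_bound_of_l1_le hm (empiricalForm x (1 - θ / 2)) (κ := θ) hθ.le
    (fun s hs => by
      rw [empiricalForm_self]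
      have := (abs_le.1 (hx s hs)).1
      linarith)
    (fun i => by
      -- `m e_i` is itself an `m`-fold sum, so the basis vectors need no separate event. By
      -- homogeneity the diagonal is at most `(1 + θ/2) - (1 - θ/2) = θ`.
      have h := (abs_le.1 (hx (Multiset.replicate m (some (i, true))) (by simp))).2
      have e : ((Multiset.replicate m (some (i, true))).map (signedBasis n)).sum =
          (m : ℝ) • EuclideanSpace.single i (1 : ℝ) := by
        simp [signedBasis, ← Nat.cast_smul_eq_nsmul ℝ]
      have h2 : empiricalForm x (1 + θ / 2) ((m : ℝ) • EuclideanSpace.single i (1 : ℝ))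
          ((m : ℝ) • EuclideanSpace.single i (1 : ℝ)) ≤ 0 := by
        rw [empiricalForm_self, ← e]; linarith
      simp only [map_smul, LinearMap.smul_apply, smul_eq_mul] at h2
      have h3 : empiricalForm x (1 + θ / 2) (EuclideanSpace.single i (1 : ℝ))
          (EuclideanSpace.single i (1 : ℝ)) ≤ 0 := by
        by_contra hcon
        push Not at hcon
        have : (0 : ℝ) < m := by linarith
        exact absurd h2 (not_le.2 (by positivity))
      rw [empiricalForm_self] at h3 ⊢
      simp only [PiLp.norm_single, norm_one, one_pow, mul_one] at h3 ⊢
      linarith)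
    (mul_pos hL hzpos) z hz
  rw [empiricalForm_self] at hlow
  have hk : θ * (L * ‖z‖) ^ 2 / (m - 1) ≤ θ / 2 * ‖z‖ ^ 2 := by
    rw [div_le_iff₀ (by linarith)]
    nlinarith [mul_nonneg hθ.le (sq_nonneg ‖z‖)]
  -- The losses `θ/2 + θ/2` leave the factor `1 - θ`, which is at least `(1 - θ)²`.
  have hsq : ((1 - θ) * ‖z‖) ^ 2 ≤ empiricalNorm x z ^ 2 := by
    nlinarith [sq_nonneg ‖z‖, mul_nonneg (mul_nonneg hθ.le (sub_nonneg.2 hθ1.le)) (sq_nonneg ‖z‖)]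
  exact (pow_le_pow_iff_left₀ (mul_nonneg (by linarith) hzpos.le) (Real.sqrt_nonneg _) two_ne_zero).1 hsq

/-! ### Bernstein's inequality for squares of `ψ₂` variables -/

/-- Strict inequality provides an admissible `u < K` directly, so attainment of the infimum need not
be shown. -/
theorem integral_exp_sq_le_two_of_psi2Norm_lt {Ω : Type*} [MeasurableSpace Ω] {P : Measure Ω}
    {Y : Ω → ℝ} (hY : Measurable Y) {K : ℝ} (h : psi2Norm Y P < ENNReal.ofReal K) :
    Integrable (fun ω => Real.exp (Y ω ^ 2 / K ^ 2)) P ∧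
      ∫ ω, Real.exp (Y ω ^ 2 / K ^ 2) ∂P ≤ 2 := by
  unfold psi2Norm at h
  simp only [iInf_lt_iff] at h
  obtain ⟨u, ⟨hu, hint⟩, huK⟩ := h
  have huK' : u < K := (ENNReal.ofReal_lt_ofReal_iff_of_nonneg hu.le).1 huK
  have hle : ∫⁻ ω, ENNReal.ofReal (Real.exp (Y ω ^ 2 / K ^ 2)) ∂P ≤ 2 := by
    refine le_trans (lintegral_mono fun ω => ?_) hint
    gcongr
  have hi : Integrable (fun ω => Real.exp (Y ω ^ 2 / K ^ 2)) P := by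
    refine ⟨by fun_prop, ?_⟩
    rw [hasFiniteIntegral_iff_ofReal (Filter.Eventually.of_forall fun ω => (Real.exp_pos _).le)]
    exact hle.trans_lt (by simp)
  refine ⟨hi, ?_⟩
  rw [integral_eq_lintegral_of_nonneg_ae (Filter.Eventually.of_forall fun ω => (Real.exp_pos _).le)
    (by fun_prop)]
  exact ENNReal.toReal_le_of_le_ofReal (by norm_num) (by simpa using hle)

/-- Integrating `1 + t ≤ exp t` gives `1 + 1 / K² ≤ 2`. It is what bounds `α` from below. -/
theorem one_le_of_integral_exp_sq_le_two {Ω : Type*} [MeasurableSpace Ω] {P : Measure Ω}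
    [IsProbabilityMeasure P] {Y : Ω → ℝ} {K : ℝ} (hK : 0 < K)
    (hi : Integrable (fun ω => Real.exp (Y ω ^ 2 / K ^ 2)) P)
    (h2 : ∫ ω, Real.exp (Y ω ^ 2 / K ^ 2) ∂P ≤ 2) (hY2 : ∫ ω, Y ω ^ 2 ∂P = 1) : 1 ≤ K := by
  have hYi : Integrable (fun ω => Y ω ^ 2) P := by
    by_contra hcon
    rw [integral_undef hcon] at hY2
    norm_num at hY2
  have h : ∫ ω, (Y ω ^ 2 / K ^ 2 + 1) ∂P ≤ ∫ ω, Real.exp (Y ω ^ 2 / K ^ 2) ∂P :=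
    integral_mono ((hYi.div_const _).add (integrable_const _)) hi
      fun ω => Real.add_one_le_exp _
  rw [integral_add (hYi.div_const _) (integrable_const _), integral_div, hY2] at h
  simp only [integral_const, probReal_univ, smul_eq_mul, mul_one] at h
  have h1 : 1 / K ^ 2 ≤ 1 := by linarith
  rw [div_le_one (by positivity)] at h1
  nlinarith

theorem exp_neg_mul_le_quadratic {K l x : ℝ} (hK : 0 < K) (hl : 0 ≤ l) (hx : 0 ≤ x) :
    Real.exp (-l * x) ≤ 1 - l * x + l ^ 2 * K ^ 4 * (Real.exp (x / K ^ 2) - 1) := by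
  have h1 : Real.exp (-l * x) ≤ 1 - l * x + (l * x) ^ 2 / 2 := by
    have hy : 0 ≤ l * x := by positivity
    have h := Real.quadratic_le_exp_of_nonneg hy
    -- With `t = l x`: `(1 - t + t²/2)(1 + t + t²/2) = 1 + t⁴/4 ≥ 1`.
    rw [neg_mul, Real.exp_neg, inv_le_iff_one_le_mul₀ (Real.exp_pos _)]
    have h' : (0 : ℝ) ≤ 1 - l * x + (l * x) ^ 2 / 2 := by nlinarith [sq_nonneg (l * x - 1)]
    nlinarith [mul_le_mul_of_nonneg_left h h', sq_nonneg ((l * x) ^ 2)]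
  have h2 : (x / K ^ 2) ^ 2 / 2 ≤ Real.exp (x / K ^ 2) - 1 := by
    have := Real.quadratic_le_exp_of_nonneg (x := x / K ^ 2) (by positivity)
    have : 0 ≤ x / K ^ 2 := by positivity
    linarith
  have h3 : (l * x) ^ 2 / 2 = l ^ 2 * K ^ 4 * ((x / K ^ 2) ^ 2 / 2) := by
    field_simp
  rw [h3] at h1
  have := mul_le_mul_of_nonneg_left h2 (show 0 ≤ l ^ 2 * K ^ 4 by positivity)
  linarith

/-- In `y² exp y` with `y = l x`, half of the exponent `x / K²` pays for the square and the other
half dominates `exp y`. -/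
theorem exp_mul_le_quadratic {K l x : ℝ} (hK : 0 < K) (hl : 0 ≤ l) (hlK : 2 * l * K ^ 2 ≤ 1)
    (hx : 0 ≤ x) :
    Real.exp (l * x) ≤ 1 + l * x + 4 * l ^ 2 * K ^ 4 * Real.exp (x / K ^ 2) := by
  have h1 : ∀ y : ℝ, 0 ≤ y → Real.exp y ≤ 1 + y + y ^ 2 * Real.exp y := by
    intro y hy
    have h := mul_le_mul_of_nonneg_left (Real.add_one_le_exp (-y))
      (mul_nonneg (show 0 ≤ 1 + y by linarith) (Real.exp_pos y).le)
    rw [mul_assoc, mul_assoc, ← Real.exp_add, add_neg_cancel, Real.exp_zero] at h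
    nlinarith
  have hlx : l * x ≤ x / K ^ 2 / 2 := by
    rw [div_div, le_div_iff₀ (by positivity)]
    nlinarith
  have h2 : (x / K ^ 2) ^ 2 ≤ 4 * Real.exp (x / K ^ 2 / 2) := by
    have h := Real.quadratic_le_exp_of_nonneg (x := x / K ^ 2 / 4) (by positivity)
    have h0 : 0 ≤ x / K ^ 2 := by positivity
    have e : Real.exp (x / K ^ 2 / 2) = Real.exp (x / K ^ 2 / 4) ^ 2 := by
      rw [← Real.exp_nat_mul]; push_cast; ring_nf
    have h' : x / K ^ 2 / 2 ≤ Real.exp (x / K ^ 2 / 4) := by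
      nlinarith [sq_nonneg (x / K ^ 2 / 4 - 1)]
    rw [e]
    nlinarith
  have h3 : (l * x) ^ 2 = l ^ 2 * K ^ 4 * (x / K ^ 2) ^ 2 := by
    field_simp
  calc Real.exp (l * x) ≤ 1 + l * x + (l * x) ^ 2 * Real.exp (l * x) := h1 _ (by positivity)
    _ ≤ 1 + l * x + (l ^ 2 * K ^ 4 * (4 * Real.exp (x / K ^ 2 / 2))) *
          Real.exp (x / K ^ 2 / 2) := by
        rw [h3]; gcongr
    _ = 1 + l * x + 4 * l ^ 2 * K ^ 4 * Real.exp (x / K ^ 2) := by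
        have : Real.exp (x / K ^ 2) = Real.exp (x / K ^ 2 / 2) * Real.exp (x / K ^ 2 / 2) := by
          rw [← Real.exp_add]; ring_nf
        rw [this]; ring

theorem integrable_exp_mul_sq {Ω : Type*} [MeasurableSpace Ω] {P : Measure Ω}
    {Y : Ω → ℝ} (hY : Measurable Y) {K l : ℝ} (hK : 0 < K)
    (hi : Integrable (fun ω => Real.exp (Y ω ^ 2 / K ^ 2)) P) (hlK : 2 * l * K ^ 2 ≤ 1) :
    Integrable (fun ω => Real.exp (l * Y ω ^ 2)) P := by
  refine hi.mono' (by fun_prop) (Filter.Eventually.of_forall fun ω => ?_)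
  rw [Real.norm_of_nonneg (Real.exp_pos _).le]
  gcongr
  rw [le_div_iff₀ (by positivity)]
  nlinarith [sq_nonneg (Y ω), mul_nonneg (sq_nonneg (Y ω)) (sub_nonneg.2 hlK)]

theorem mgf_sq_le_of_nonpos {Ω : Type*} [MeasurableSpace Ω] {P : Measure Ω}
    [IsProbabilityMeasure P] {Y : Ω → ℝ} (hY : Measurable Y) {K l : ℝ} (hK : 0 < K)
    (hi : Integrable (fun ω => Real.exp (Y ω ^ 2 / K ^ 2)) P)
    (h2 : ∫ ω, Real.exp (Y ω ^ 2 / K ^ 2) ∂P ≤ 2) (hY2 : ∫ ω, Y ω ^ 2 ∂P = 1)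
    (hl : 0 ≤ l) : mgf (fun ω => Y ω ^ 2) P (-l) ≤ Real.exp (-l + l ^ 2 * K ^ 4) := by
  have hYi : Integrable (fun ω => Y ω ^ 2) P := by
    by_contra hcon
    rw [integral_undef hcon] at hY2
    norm_num at hY2
  have a1 : Integrable (fun ω => 1 - l * Y ω ^ 2) P :=
    (integrable_const _).sub (hYi.const_mul _)
  have a2 : Integrable (fun ω => l ^ 2 * K ^ 4 * (Real.exp (Y ω ^ 2 / K ^ 2) - 1)) P :=
    (hi.sub (integrable_const _)).const_mul _
  have h : ∫ ω, Real.exp (-l * Y ω ^ 2) ∂P ≤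
      ∫ ω, (1 - l * Y ω ^ 2 + l ^ 2 * K ^ 4 * (Real.exp (Y ω ^ 2 / K ^ 2) - 1)) ∂P :=
    integral_mono (integrable_exp_mul_sq hY hK hi (by nlinarith [sq_nonneg K]))
      (a1.add a2)
      fun ω => exp_neg_mul_le_quadratic hK hl (sq_nonneg _)
  rw [integral_add a1 a2, integral_sub (integrable_const _)
    (hYi.const_mul _), integral_const_mul, integral_const_mul,
    integral_sub hi (integrable_const _), hY2] at h
  simp only [integral_const, probReal_univ, smul_eq_mul, mul_one] at h
  have := mul_le_mul_of_nonneg_left h2 (show 0 ≤ l ^ 2 * K ^ 4 by positivity)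
  calc mgf (fun ω => Y ω ^ 2) P (-l) ≤ (-l + l ^ 2 * K ^ 4) + 1 := by
        unfold mgf; linarith
    _ ≤ _ := Real.add_one_le_exp _

theorem mgf_sq_le_of_nonneg {Ω : Type*} [MeasurableSpace Ω] {P : Measure Ω}
    [IsProbabilityMeasure P] {Y : Ω → ℝ} (hY : Measurable Y) {K l : ℝ} (hK : 0 < K)
    (hi : Integrable (fun ω => Real.exp (Y ω ^ 2 / K ^ 2)) P)
    (h2 : ∫ ω, Real.exp (Y ω ^ 2 / K ^ 2) ∂P ≤ 2) (hY2 : ∫ ω, Y ω ^ 2 ∂P = 1)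
    (hl : 0 ≤ l) (hlK : 2 * l * K ^ 2 ≤ 1) :
    mgf (fun ω => Y ω ^ 2) P l ≤ Real.exp (l + 8 * l ^ 2 * K ^ 4) := by
  have hYi : Integrable (fun ω => Y ω ^ 2) P := by
    by_contra hcon
    rw [integral_undef hcon] at hY2
    norm_num at hY2
  have a1 : Integrable (fun ω => 1 + l * Y ω ^ 2) P :=
    (integrable_const _).add (hYi.const_mul _)
  have h : ∫ ω, Real.exp (l * Y ω ^ 2) ∂P ≤
      ∫ ω, (1 + l * Y ω ^ 2 + 4 * l ^ 2 * K ^ 4 * Real.exp (Y ω ^ 2 / K ^ 2)) ∂P :=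
    integral_mono (integrable_exp_mul_sq hY hK hi hlK)
      (a1.add (hi.const_mul _))
      fun ω => exp_mul_le_quadratic hK hl hlK (sq_nonneg _)
  rw [integral_add a1 (hi.const_mul _),
    integral_add (integrable_const _) (hYi.const_mul _), integral_const_mul,
    integral_const_mul, hY2] at h
  simp only [integral_const, probReal_univ, smul_eq_mul, mul_one] at h
  have := mul_le_mul_of_nonneg_left h2 (show 0 ≤ 4 * l ^ 2 * K ^ 4 by positivity)
  calc mgf (fun ω => Y ω ^ 2) P l ≤ (l + 8 * l ^ 2 * K ^ 4) + 1 := by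
        unfold mgf; linarith
    _ ≤ _ := Real.add_one_le_exp _

/-- Bernstein's inequality for the mean of independent copies of the square of a `ψ₂` variable. -/
theorem measure_abs_mean_sq_sub_one_ge_le {Ω E : Type*} [MeasurableSpace Ω] [MeasurableSpace E]
    {P : Measure Ω} [IsProbabilityMeasure P] {μ : Measure E} [IsProbabilityMeasure μ] {k : ℕ}
    (hk : 1 ≤ k) {X : Fin k → Ω → E} (hX : ∀ i, HasLaw (X i) μ P) (hind : iIndepFun X P)
    {Y : E → ℝ} (hY : Measurable Y) {K δ : ℝ} (hK : 1 ≤ K) (hδ : 0 ≤ δ) (hδ1 : δ ≤ 1)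
    (hi : Integrable (fun x => Real.exp (Y x ^ 2 / K ^ 2)) μ)
    (h2 : ∫ x, Real.exp (Y x ^ 2 / K ^ 2) ∂μ ≤ 2) (hY2 : ∫ x, Y x ^ 2 ∂μ = 1) :
    P.real {ω | δ < |(∑ i, Y (X i ω) ^ 2) / (k : ℝ) - 1|} ≤
      2 * Real.exp (-(k * (δ ^ 2 / (32 * K ^ 4)))) := by
  have hK0 : 0 < K := by linarith
  have hk0 : (0 : ℝ) < k := by exact_mod_cast hk
  have hmeasX : ∀ i, AEMeasurable (X i) P := fun i => (hX i).aemeasurable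
  have hind2 : iIndepFun (fun i ω => Y (X i ω) ^ 2) P :=
    hind.comp (fun _ x => Y x ^ 2) fun _ => by fun_prop
  have hae : ∀ i, AEMeasurable (fun ω => Y (X i ω) ^ 2) P := fun i =>
    (show Measurable fun x => Y x ^ 2 by fun_prop).comp_aemeasurable (hmeasX i)
  have hmgf : ∀ t, ∀ i, mgf (fun ω => Y (X i ω) ^ 2) P t = mgf (fun x => Y x ^ 2) μ t := by
    intro t i
    have := (hX i).integral_comp (f := fun x => Real.exp (t * Y x ^ 2))
      (by fun_prop : Measurable _).aestronglyMeasurable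
    simpa [mgf, Function.comp_def] using this
  have hsum : ∀ t, mgf (∑ i, fun ω => Y (X i ω) ^ 2) P t = mgf (fun x => Y x ^ 2) μ t ^ k := by
    intro t
    rw [hind2.mgf_sum₀ hae]
    simp [hmgf]
  have hint : ∀ t, 2 * t * K ^ 2 ≤ 1 →
      Integrable (fun ω => Real.exp (t * (∑ i, fun ω => Y (X i ω) ^ 2) ω)) P := by
    intro t ht
    -- A non-integrable exponential would make `mgf` take its default value `0`, whereas the product
    -- formula makes it positive.
    by_contra hcon
    have h0 : mgf (∑ i, fun ω => Y (X i ω) ^ 2) P t = 0 := integral_undef hcon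
    rw [hsum] at h0
    exact (pow_pos (mgf_pos (integrable_exp_mul_sq hY hK0 hi ht)) k).ne' h0
  set S : Ω → ℝ := ∑ i, fun ω => Y (X i ω) ^ 2 with hS
  have hSapp : ∀ ω, S ω = ∑ i, Y (X i ω) ^ 2 := fun ω => by simp [hS]
  -- Minimizes the upper-tail exponent `-l δ + 8 l² K⁴`; the lower tail has room to spare.
  set l : ℝ := δ / (16 * K ^ 4) with hl
  have hl0 : 0 ≤ l := by positivity
  have hlδ : l * K ^ 4 = δ / 16 := by rw [hl]; field_simp
  have hlK : 2 * l * K ^ 2 ≤ 1 := by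
    have : K ^ 2 ≤ K ^ 4 := pow_le_pow_right₀ hK (by norm_num)
    nlinarith
  have hexp : δ ^ 2 / (32 * K ^ 4) = l * δ / 2 := by rw [hl]; field_simp; ring
  have hup : P.real {ω | k * (1 + δ) ≤ S ω} ≤ Real.exp (-(k * (δ ^ 2 / (32 * K ^ 4)))) := by
    refine (measure_ge_le_exp_mul_mgf _ hl0 (hint l hlK)).trans ?_
    rw [hsum]
    calc _ ≤ Real.exp (-l * (k * (1 + δ))) * Real.exp (l + 8 * l ^ 2 * K ^ 4) ^ k := by
          gcongr
          · exact mgf_nonneg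
          · exact mgf_sq_le_of_nonneg hY hK0 hi h2 hY2 hl0 hlK
      _ = Real.exp (-(k * (δ ^ 2 / (32 * K ^ 4)))) := by
          rw [← Real.exp_nat_mul, ← Real.exp_add, hexp]
          congr 1
          linear_combination 8 * k * l * hlδ
  have hdown : P.real {ω | S ω ≤ k * (1 - δ)} ≤ Real.exp (-(k * (δ ^ 2 / (32 * K ^ 4)))) := by
    refine (measure_le_le_exp_mul_mgf _ (neg_nonpos.2 hl0)
      (hint (-l) (by nlinarith [sq_nonneg K]))).trans ?_
    rw [hsum]
    calc _ ≤ Real.exp (-(-l) * (k * (1 - δ))) * Real.exp (-l + l ^ 2 * K ^ 4) ^ k := by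
          gcongr
          · exact mgf_nonneg
          · exact mgf_sq_le_of_nonpos hY hK0 hi h2 hY2 hl0
      _ ≤ Real.exp (-(k * (δ ^ 2 / (32 * K ^ 4)))) := by
          rw [← Real.exp_nat_mul, ← Real.exp_add, hexp]
          gcongr
          have e : l ^ 2 * K ^ 4 = l * δ / 16 := by linear_combination l * hlδ
          rw [e]
          have : 0 ≤ k * (l * δ) := by positivity
          nlinarith
  have hsub : {ω | δ < |(∑ i, Y (X i ω) ^ 2) / (k : ℝ) - 1|} ⊆
      {ω | k * (1 + δ) ≤ S ω} ∪ {ω | S ω ≤ k * (1 - δ)} := by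
    intro ω hω
    simp only [Set.mem_ofPred_eq, Set.mem_union, hSapp] at hω ⊢
    rcases lt_abs.1 hω with h | h
    · left
      have : 1 + δ < (∑ i, Y (X i ω) ^ 2) / (k : ℝ) := by linarith
      rw [lt_div_iff₀ hk0] at this
      linarith
    · right
      have : (∑ i, Y (X i ω) ^ 2) / (k : ℝ) < 1 - δ := by linarith
      rw [div_lt_iff₀ hk0] at this
      linarith
  calc _ ≤ P.real ({ω | k * (1 + δ) ≤ S ω} ∪ {ω | S ω ≤ k * (1 - δ)}) := measureReal_mono hsub
    _ ≤ _ := measureReal_union_le _ _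
    _ ≤ _ := by linarith

/-! ### Rearrangements and power decay -/

/-- The right side is `∫ x^(-q)` over `[j, j + 1]`; it telescopes when summed. -/
theorem neg_rpow_le_sub {q : ℝ} (hq : 1 < q) {j : ℝ} (hj : 0 < j) :
    (j + 1) ^ (-q) ≤ (q - 1)⁻¹ * (j ^ (1 - q) - (j + 1) ^ (1 - q)) := by
  have hj1 : 0 < j + 1 := by linarith
  have hq0 : 0 < q - 1 := by linarith
  have hlog : 1 / (j + 1) ≤ Real.log (j + 1) - Real.log j := by
    have h := Real.log_le_sub_one_of_pos (show 0 < j / (j + 1) by positivity)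
    rw [Real.log_div hj.ne' hj1.ne'] at h
    have e : j / (j + 1) - 1 = -(1 / (j + 1)) := by field_simp; ring
    linarith
  have hexp := Real.add_one_le_exp ((q - 1) * (Real.log (j + 1) - Real.log j))
  have e1 : j ^ (1 - q) =
      (j + 1) ^ (1 - q) * Real.exp ((q - 1) * (Real.log (j + 1) - Real.log j)) := by
    rw [Real.rpow_def_of_pos hj, Real.rpow_def_of_pos hj1, ← Real.exp_add]
    ring_nf
  have e2 : (j + 1) ^ (-q) = (j + 1) ^ (1 - q) * (1 / (j + 1)) := by
    rw [show -q = (1 - q) - 1 by ring, Real.rpow_sub_one hj1.ne']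
    ring
  rw [← div_eq_inv_mul, le_div_iff₀ hq0, e1, e2]
  have hpos : 0 < (j + 1) ^ (1 - q) := by positivity
  have h3 := mul_le_mul_of_nonneg_left hlog hq0.le
  have h4 : (q - 1) * (1 / (j + 1)) ≤
      Real.exp ((q - 1) * (Real.log (j + 1) - Real.log j)) - 1 := by linarith
  have h5 := mul_le_mul_of_nonneg_left h4 hpos.le
  linarith

/-- Tail sums of `i ↦ i ^ (-q)` for `q > 1`. -/
theorem sum_Ico_rpow_neg_le {q : ℝ} (hq : 1 < q) {s : ℕ} (hs : 1 ≤ s) (n : ℕ) :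
    ∑ i ∈ Finset.Ico s n, ((i : ℝ) + 1) ^ (-q) ≤ (q - 1)⁻¹ * (s : ℝ) ^ (1 - q) := by
  rcases le_total n s with hns | hns
  · rw [Finset.Ico_eq_empty_of_le hns, Finset.sum_empty]
    have : 0 ≤ (q - 1)⁻¹ := inv_nonneg.2 (by linarith)
    positivity
  have hstrong : ∑ i ∈ Finset.Ico s n, ((i : ℝ) + 1) ^ (-q) ≤
      (q - 1)⁻¹ * ((s : ℝ) ^ (1 - q) - (n : ℝ) ^ (1 - q)) := by
    induction n, hns using Nat.le_induction with
    | base => simp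
    | succ m hm ih =>
      rw [Finset.sum_Ico_succ_top hm]
      have := neg_rpow_le_sub hq (j := m) (by exact_mod_cast (by omega : 0 < m))
      push_cast
      linarith
  refine hstrong.trans (mul_le_mul_of_nonneg_left ?_ (inv_nonneg.2 (by linarith)))
  have : (0 : ℝ) ≤ (n : ℝ) ^ (1 - q) := by positivity
  linarith

theorem exists_perm_antitone_abs {n : ℕ} (z : Fin n → ℝ) :
    ∃ σ : Equiv.Perm (Fin n), Antitone fun i => |z (σ i)| := by
  refine ⟨Tuple.sort fun i => -|z i|, fun i j hij => ?_⟩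
  have := Tuple.monotone_sort (fun i => -|z i|) hij
  simpa using this

/-- The decreasing rearrangement of a difference of vectors in the weak `ℓ_p` ball. -/
theorem abs_sub_perm_le_of_mem_weakLpBall {n : ℕ} {p : ℝ} (hp : 0 < p)
    {v y : EuclideanSpace ℝ (Fin n)} (hv : v ∈ weakLpBall n p) (hy : y ∈ weakLpBall n p)
    {σ : Equiv.Perm (Fin n)} (hσ : Antitone fun i => |(v - y) (σ i)|) (i : Fin n) :
    |(v - y) (σ i)| ≤ 2 ^ (1 / p + 1) * ((i : ℝ) + 1) ^ (-(1 / p)) := by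
  set s := |(v - y) (σ i)| with hs
  rcases (abs_nonneg ((v - y) (σ i))).eq_or_lt with h0 | hpos
  · rw [hs, ← h0]; positivity
  rw [← hs] at hpos
  have hcount : ((i : ℝ) + 1) ≤ 2 * (s / 2) ^ (-p) := by
    -- The first `i + 1` rearranged entries are at least `s`, so at each of these indices `v` or `y`
    -- is at least `s / 2` in absolute value.
    have hsub : ((Finset.Iic i).map σ.toEmbedding : Set (Fin n)) ⊆
        {j | s / 2 ≤ |v j|} ∪ {j | s / 2 ≤ |y j|} := by
      intro j hj
      simp only [Finset.coe_map, Set.mem_image, Finset.coe_Iic, Set.mem_Iic] at hj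
      obtain ⟨l, hl, rfl⟩ := hj
      have h1 : s ≤ |(v - y) (σ l)| := hσ hl
      have h2 : |(v - y) (σ l)| ≤ |v (σ l)| + |y (σ l)| := by
        rw [PiLp.sub_apply]; exact abs_sub _ _
      by_contra hcon
      simp only [Set.mem_union, Set.mem_ofPred_eq, not_or, not_le, Equiv.coe_toEmbedding] at hcon
      linarith [hcon.1, hcon.2]
    have hc := (Set.ncard_le_ncard hsub (Set.toFinite _)).trans (Set.ncard_union_le _ _)
    rw [Set.ncard_coe_finset, Finset.card_map, Fin.card_Iic] at hc
    have hv' := hv (s / 2) (by positivity)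
    have hy' := hy (s / 2) (by positivity)
    have hc' : ((i : ℝ) + 1) ≤ (Set.ncard {j | s / 2 ≤ |v j|} : ℝ) +
        (Set.ncard {j | s / 2 ≤ |y j|} : ℝ) := by exact_mod_cast hc
    linarith
  have hi : (0 : ℝ) < (i : ℝ) + 1 := by positivity
  have h1 : (s / 2) ^ p ≤ 2 / ((i : ℝ) + 1) := by
    rw [le_div_iff₀ hi]
    rw [Real.rpow_neg (by positivity), ← div_eq_mul_inv, le_div_iff₀ (by positivity)] at hcount
    linarith
  have h2 := Real.rpow_le_rpow (by positivity) h1 (show 0 ≤ 1 / p by positivity)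
  rw [← Real.rpow_mul (by positivity), mul_one_div_cancel hp.ne', Real.rpow_one,
    Real.div_rpow (by norm_num) hi.le] at h2
  rw [Real.rpow_add (by norm_num), Real.rpow_one, Real.rpow_neg hi.le]
  calc s = 2 * (s / 2) := by ring
    _ ≤ 2 * (2 ^ (1 / p) / ((i : ℝ) + 1) ^ (1 / p)) := by linarith
    _ = _ := by ring

/-- The `ℓ₁` norm of a vector with coordinates decaying like `A i ^ (-q)`, `q > 1`. -/
theorem sum_abs_le_of_decay {n : ℕ} {z : EuclideanSpace ℝ (Fin n)} {A q : ℝ} (hA : 0 ≤ A)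
    (hq : 1 < q) (σ : Equiv.Perm (Fin n))
    (hz : ∀ i : Fin n, |z (σ i)| ≤ A * ((i : ℝ) + 1) ^ (-q)) {s : ℕ} (hs : 1 ≤ s) :
    ∑ i, |z i| ≤ √s * ‖z‖ + A * ((q - 1)⁻¹ * (s : ℝ) ^ (1 - q)) := by
  rw [← Equiv.sum_comp σ, ← Finset.sum_filter_add_sum_filter_not _ (fun i : Fin n => (i : ℕ) < s)]
  -- Cauchy–Schwarz on the `s` largest positions, the decay on the rest.
  refine add_le_add ?_ ?_
  · have hcs := sq_sum_le_card_mul_sum_sq (s := Finset.univ.filter fun i : Fin n => (i : ℕ) < s)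
      (f := fun i => |z (σ i)|)
    have hcard : ((Finset.univ.filter fun i : Fin n => (i : ℕ) < s).card : ℝ) ≤ s := by
      have : (Finset.univ.filter fun i : Fin n => (i : ℕ) < s).card ≤ (Finset.range s).card :=
        Finset.card_le_card_of_injOn (fun i => (i : ℕ)) (fun i hi => by simpa using hi)
          (Fin.val_injective.injOn)
      rw [Finset.card_range] at this
      exact_mod_cast this
    have hnorm : ∑ i ∈ Finset.univ.filter (fun i : Fin n => (i : ℕ) < s), |z (σ i)| ^ 2 ≤
        ‖z‖ ^ 2 := by
      rw [EuclideanSpace.norm_sq_eq, ← Equiv.sum_comp σ]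
      exact Finset.sum_le_sum_of_subset_of_nonneg (Finset.filter_subset _ _)
        fun i _ _ => sq_nonneg _
    refine (pow_le_pow_iff_left₀ (Finset.sum_nonneg fun i _ => abs_nonneg _) (by positivity)
      two_ne_zero).1 ?_
    rw [mul_pow, Real.sq_sqrt (by positivity)]
    exact hcs.trans (mul_le_mul hcard hnorm (Finset.sum_nonneg fun i _ => sq_nonneg _)
      (by positivity))
  · calc _ ≤ ∑ i ∈ Finset.univ.filter (fun i : Fin n => ¬ (i : ℕ) < s),
          A * (((i : ℕ) : ℝ) + 1) ^ (-q) := Finset.sum_le_sum fun i _ => hz i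
      _ = A * ∑ i ∈ Finset.Ico s n, ((i : ℝ) + 1) ^ (-q) := by
          rw [Finset.mul_sum]
          refine Finset.sum_bij (fun i _ => (i : ℕ)) ?_ ?_ ?_ ?_
          · intro i hi
            simp only [Finset.mem_filter, Finset.mem_univ, true_and, not_lt] at hi
            exact Finset.mem_Ico.2 ⟨hi, i.2⟩
          · exact fun i _ j _ h => Fin.ext h
          · intro j hj
            rw [Finset.mem_Ico] at hj
            exact ⟨⟨j, hj.2⟩, by simpa using hj.1, rfl⟩
          · exact fun _ _ => rfl
      _ ≤ _ := mul_le_mul_of_nonneg_left (sum_Ico_rpow_neg_le hq hs n) hA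

/-- The Euclidean norm of a vector with coordinates decaying like `A i ^ (-q)`, `q ≥ 1`. -/
theorem norm_le_of_decay {n : ℕ} {z : EuclideanSpace ℝ (Fin n)} {A q : ℝ} (hA : 0 ≤ A)
    (hq : 1 < q) (σ : Equiv.Perm (Fin n))
    (hz : ∀ i : Fin n, |z (σ i)| ≤ A * ((i : ℝ) + 1) ^ (-q)) : ‖z‖ ≤ 2 * A := by
  have hsum : ∑ i ∈ Finset.range n, ((i : ℝ) + 1) ^ (-(2 : ℝ)) ≤ 2 := by
    rcases Nat.eq_zero_or_pos n with rfl | hn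
    · simp
    · rw [Finset.range_eq_Ico, Finset.sum_eq_sum_Ico_succ_bot hn]
      have := sum_Ico_rpow_neg_le (q := 2) (by norm_num) le_rfl n
      norm_num at this ⊢
      linarith
  refine (pow_le_pow_iff_left₀ (norm_nonneg _) (by positivity) two_ne_zero).1 ?_
  rw [EuclideanSpace.norm_sq_eq, ← Equiv.sum_comp σ]
  calc ∑ i, ‖z (σ i)‖ ^ 2 ≤ ∑ i : Fin n, A ^ 2 * (((i : ℕ) : ℝ) + 1) ^ (-(2 : ℝ)) := by
        refine Finset.sum_le_sum fun i _ => ?_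
        have hb : (1 : ℝ) ≤ (i : ℝ) + 1 := by simp
        have h1 : |z (σ i)| ≤ A * ((i : ℝ) + 1) ^ (-(1 : ℝ)) :=
          (hz i).trans (mul_le_mul_of_nonneg_left
            (Real.rpow_le_rpow_of_exponent_le hb (by linarith)) hA)
        have h2 := pow_le_pow_left₀ (abs_nonneg _) h1 2
        rw [mul_pow, ← Real.rpow_mul_natCast (by positivity)] at h2
        norm_num at h2 ⊢
        exact h2
    _ = A ^ 2 * ∑ i ∈ Finset.range n, ((i : ℝ) + 1) ^ (-(2 : ℝ)) := by
        rw [← Finset.mul_sum,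
          Fin.sum_univ_eq_sum_range (fun i : ℕ => ((i : ℝ) + 1) ^ (-(2 : ℝ)))]
    _ ≤ A ^ 2 * 2 := mul_le_mul_of_nonneg_left hsum (sq_nonneg _)
    _ ≤ (2 * A) ^ 2 := by nlinarith [sq_nonneg A]

/-! ### Comparing `ℓ₁` and Euclidean norms of differences -/

/-- Split at `s = ⌈1/ρ⌉`. The tail is at most `√s` times the radius in `h`, hence at most `√s ‖v -
y‖`, like the head. Since `ρ < 4` forces `s ≤ 5/ρ`, the total `2√s` is at most `√(20/ρ)`. -/
theorem sum_abs_le_of_weakLp_of_lt_norm {n : ℕ} {p ρ : ℝ} (hp : 0 < p) (hp1 : p < 1)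
    (hρ : 0 < ρ) (hρ4 : ρ < 4) {v y : EuclideanSpace ℝ (Fin n)} (hv : v ∈ weakLpBall n p)
    (hy : y ∈ weakLpBall n p)
    (h : (2 : ℝ) ^ (1 / p + 1) * (1 / p - 1)⁻¹ * ρ ^ (1 / p - 1 / 2) < ‖v - y‖) :
    ∑ i, |(v - y) i| ≤ √(20 / ρ) * ‖v - y‖ := by
  obtain ⟨σ, hσ⟩ := exists_perm_antitone_abs (v - y).ofLp
  have hq : 1 < 1 / p := by rw [lt_div_iff₀ hp]; linarith
  set q := 1 / p with hqdef
  have hs1 : 1 / ρ ≤ (⌈1 / ρ⌉₊ : ℝ) := Nat.le_ceil _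
  have hs2 : (⌈1 / ρ⌉₊ : ℝ) ≤ 5 / ρ := by
    have h1 := (Nat.ceil_lt_add_one (show 0 ≤ 1 / ρ by positivity)).le
    have h2 : 1 / ρ + 1 ≤ 5 / ρ := by
      rw [← sub_nonneg, show 5 / ρ - (1 / ρ + 1) = (4 - ρ) / ρ by field_simp; ring]
      exact div_nonneg (by linarith) hρ.le
    linarith
  have hs : 1 ≤ ⌈1 / ρ⌉₊ := Nat.one_le_iff_ne_zero.2 (Nat.ceil_pos.2 (by positivity)).ne'
  set s := ⌈1 / ρ⌉₊
  have hs0 : (0 : ℝ) < s := by exact_mod_cast hs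
  refine (sum_abs_le_of_decay (A := 2 ^ (q + 1)) (by positivity) hq σ
    (abs_sub_perm_le_of_mem_weakLpBall hp hv hy hσ) hs).trans ?_
  have hpow : (s : ℝ) ^ (1 - q) ≤ √s * ρ ^ (q - 1 / 2) := by
    rw [Real.sqrt_eq_rpow, show 1 - q = 1 / 2 + (1 / 2 - q) by ring, Real.rpow_add hs0]
    refine mul_le_mul_of_nonneg_left ?_ (by positivity)
    calc (s : ℝ) ^ (1 / 2 - q) ≤ (1 / ρ) ^ (1 / 2 - q) :=
          Real.rpow_le_rpow_of_nonpos (by positivity) hs1 (by linarith)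
      _ = ρ ^ (q - 1 / 2) := by
          rw [one_div, Real.inv_rpow hρ.le, ← Real.rpow_neg hρ.le]; ring_nf
  have hq0 : 0 ≤ (q - 1)⁻¹ := inv_nonneg.2 (by linarith)
  have htail : (2 : ℝ) ^ (q + 1) * ((q - 1)⁻¹ * (s : ℝ) ^ (1 - q)) ≤ √s * ‖v - y‖ := by
    calc _ ≤ (2 : ℝ) ^ (q + 1) * ((q - 1)⁻¹ * (√s * ρ ^ (q - 1 / 2))) := by gcongr
      _ = √s * (2 ^ (q + 1) * (q - 1)⁻¹ * ρ ^ (q - 1 / 2)) := by ring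
      _ ≤ _ := by gcongr
  have hsqrt : 2 * √s ≤ √(20 / ρ) := by
    refine Real.le_sqrt_of_sq_le ?_
    rw [mul_pow, Real.sq_sqrt hs0.le, show 20 / ρ = 4 * (5 / ρ) by ring]
    linarith
  nlinarith [norm_nonneg (v - y)]

/-- Decay alone gives `‖v - y‖ ≤ 2 · 2^(q+1)` with `q = 1/p`, and `ρ^(q - 1/2) ≥ 2 · 4^(q-1) ≥ 2 (q
- 1)` absorbs the factor `(q - 1)⁻¹`. -/
theorem norm_sub_le_of_weakLp_of_four_le {n : ℕ} {p ρ : ℝ} (hp : 0 < p) (hp1 : p < 1)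
    (hρ4 : 4 ≤ ρ) {v y : EuclideanSpace ℝ (Fin n)} (hv : v ∈ weakLpBall n p)
    (hy : y ∈ weakLpBall n p) :
    ‖v - y‖ ≤ (2 : ℝ) ^ (1 / p + 1) * (1 / p - 1)⁻¹ * ρ ^ (1 / p - 1 / 2) := by
  obtain ⟨σ, hσ⟩ := exists_perm_antitone_abs (v - y).ofLp
  have hq : 1 < 1 / p := by rw [lt_div_iff₀ hp]; linarith
  refine (norm_le_of_decay (A := 2 ^ (1 / p + 1)) (by positivity) hq σ
    (abs_sub_perm_le_of_mem_weakLpBall hp hv hy hσ)).trans ?_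
  set q := 1 / p
  have hq0 : 0 < q - 1 := by linarith
  have h4 : (4 : ℝ) ^ (q - 1 / 2) = 2 * 4 ^ (q - 1) := by
    rw [show q - 1 / 2 = 1 / 2 + (q - 1) by ring, Real.rpow_add (by norm_num),
      ← Real.sqrt_eq_rpow, show (4 : ℝ) = 2 ^ 2 by norm_num, Real.sqrt_sq (by norm_num)]
  have hb : q - 1 ≤ (4 : ℝ) ^ (q - 1) := by
    have h2 : (1 : ℝ) ≤ Real.log 4 := by
      rw [Real.le_log_iff_exp_le (by norm_num)]
      linarith [Real.exp_one_lt_d9]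
    rw [Real.rpow_def_of_pos (by norm_num)]
    nlinarith [Real.add_one_le_exp (Real.log 4 * (q - 1))]
  have hρ : 2 * (q - 1) ≤ ρ ^ (q - 1 / 2) := by
    have := Real.rpow_le_rpow (by norm_num) hρ4 (show 0 ≤ q - 1 / 2 by linarith)
    linarith
  calc 2 * (2 : ℝ) ^ (q + 1) = 2 ^ (q + 1) * (q - 1)⁻¹ * (2 * (q - 1)) := by
        field_simp
    _ ≤ _ := by gcongr

theorem sum_abs_sub_le_two {n : ℕ} {v y : EuclideanSpace ℝ (Fin n)} (hv : v ∈ l1Ball n)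
    (hy : y ∈ l1Ball n) : ∑ i, |(v - y) i| ≤ 2 := by
  calc ∑ i, |(v - y) i| ≤ ∑ i, (|v i| + |y i|) :=
        Finset.sum_le_sum fun i _ => by rw [PiLp.sub_apply]; exact abs_sub _ _
    _ = ∑ i, |v i| + ∑ i, |y i| := Finset.sum_add_distrib
    _ ≤ 2 := by
        have h1 : ∑ i, |v i| ≤ 1 := hv
        have h2 : ∑ i, |y i| ≤ 1 := hy
        linarith

theorem norm_le_sum_abs {n : ℕ} (z : EuclideanSpace ℝ (Fin n)) : ‖z‖ ≤ ∑ i, |z i| := by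
  refine (pow_le_pow_iff_left₀ (norm_nonneg _) (Finset.sum_nonneg fun i _ => abs_nonneg _)
    two_ne_zero).1 ?_
  rw [EuclideanSpace.norm_sq_eq]
  exact Finset.sum_sq_le_sq_sum_of_nonneg fun i _ => abs_nonneg (z i)

theorem sum_abs_le_of_l1_of_lt_norm {n : ℕ} {ρ : ℝ} (hρ : 0 < ρ)
    {v y : EuclideanSpace ℝ (Fin n)} (hv : v ∈ l1Ball n) (hy : y ∈ l1Ball n)
    (h : ρ ^ (1 / 2 : ℝ) < ‖v - y‖) :
    ∑ i, |(v - y) i| ≤ √(20 / ρ) * ‖v - y‖ := by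
  rw [← Real.sqrt_eq_rpow] at h
  calc ∑ i, |(v - y) i| ≤ 2 := sum_abs_sub_le_two hv hy
    _ ≤ √(20 / ρ) * √ρ := by
        rw [← Real.sqrt_mul (by positivity), div_mul_cancel₀ _ hρ.ne']
        exact Real.le_sqrt_of_sq_le (by norm_num)
    _ ≤ _ := by gcongr

/-! ### Counting and the union bound -/

/-- Sums depend only on the multiset of summands. Counting multisets rather than sequences gains the
factor `m!`, which turns `n` into `n / m` and yields the logarithm of `n / k` in the rate. -/
theorem card_sym_signed_le {n m : ℕ} (hm : 1 ≤ m) (hmn : m ≤ n) :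
    (Fintype.card (Sym (Option (Fin n × Bool)) m) : ℝ) ≤
      (Real.exp 1 * (3 * n / m)) ^ m := by
  have hm0 : (0 : ℝ) < m := by exact_mod_cast hm
  have hcard : Fintype.card (Sym (Option (Fin n × Bool)) m) ≤ (3 * n).choose m := by
    rw [Sym.card_sym_eq_choose]
    refine Nat.choose_le_choose _ ?_
    simp only [Fintype.card_option, Fintype.card_prod, Fintype.card_fin, Fintype.card_bool]
    omega
  have h1 : (Fintype.card (Sym (Option (Fin n × Bool)) m) : ℝ) ≤
      ((3 * n : ℕ) : ℝ) ^ m / (m.factorial : ℝ) :=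
    (Nat.cast_le.2 hcard).trans (Nat.choose_le_pow_div m (3 * n))
  have h2 : (m : ℝ) ^ m / (m.factorial : ℝ) ≤ Real.exp m :=
    Real.pow_div_factorial_le_exp _ hm0.le m
  have h3 : (Real.exp 1 * (3 * n / m)) ^ m = Real.exp m * (3 * (n : ℝ) / m) ^ m := by
    rw [mul_pow, ← Real.exp_nat_mul, mul_one]
  rw [h3]
  refine h1.trans ?_
  push_cast
  calc (3 * (n : ℝ)) ^ m / (m.factorial : ℝ) =
        (m : ℝ) ^ m / (m.factorial : ℝ) * (3 * (n : ℝ) / m) ^ m := by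
        rw [div_pow]; field_simp
    _ ≤ _ := by gcongr

/-- With high probability the empirical norm almost preserves the norms of finitely many vectors. -/
theorem exists_event_empiricalNorm {n k : ℕ} (hk : 1 ≤ k)
    {μ : Measure (EuclideanSpace ℝ (Fin n))} [IsProbabilityMeasure μ] (hiso : IsIsotropic μ)
    {K : ℝ} (hK : 1 ≤ K)
    (hψ : ∀ y : EuclideanSpace ℝ (Fin n), ‖y‖ = 1 →
      Integrable (fun x => Real.exp ((inner ℝ x y) ^ 2 / K ^ 2)) μ ∧
        ∫ x, Real.exp ((inner ℝ x y) ^ 2 / K ^ 2) ∂μ ≤ 2)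
    {Ω : Type*} [MeasurableSpace Ω] {P : Measure Ω} [IsProbabilityMeasure P]
    {X : Fin k → Ω → EuclideanSpace ℝ (Fin n)} (hX : ∀ i, HasLaw (X i) μ P)
    (hind : iIndepFun X P) {δ : ℝ} (hδ : 0 ≤ δ) (hδ1 : δ ≤ 1)
    {J : Type*} [Fintype J] (w : J → EuclideanSpace ℝ (Fin n)) :
    ∃ E : Set Ω, MeasurableSet E ∧
      1 - Fintype.card J * (2 * Real.exp (-(k * (δ ^ 2 / (32 * K ^ 4))))) ≤ P.real E ∧
      ∀ ω ∈ E, ∀ j, |empiricalNorm (fun i => X i ω) (w j) ^ 2 - ‖w j‖ ^ 2| ≤ δ * ‖w j‖ ^ 2 := by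
  let bad : J → Set Ω := fun j =>
    {ω | δ * ‖w j‖ ^ 2 < |empiricalNorm (fun i => X i ω) (w j) ^ 2 - ‖w j‖ ^ 2|}
  have hbad : ∀ j, P.real (bad j) ≤ 2 * Real.exp (-(k * (δ ^ 2 / (32 * K ^ 4)))) := by
    intro j
    -- Signed basis vectors may cancel, so zero vectors do occur; all others are normalized by
    -- homogeneity.
    rcases eq_or_ne (w j) 0 with h0 | h0
    · have : bad j = ∅ := by
        ext ω
        simp [bad, h0, empiricalNorm]
      rw [this, measureReal_empty]
      positivity
    · have hpos : 0 < ‖w j‖ := norm_pos_iff.2 h0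
      have hunit : ‖(‖w j‖⁻¹ • w j)‖ = 1 := by
        rw [norm_smul, norm_inv, norm_norm, inv_mul_cancel₀ hpos.ne']
      have hbern := measure_abs_mean_sq_sub_one_ge_le hk hX hind
        (Y := fun x => inner ℝ x (‖w j‖⁻¹ • w j)) (by fun_prop) hK hδ hδ1
        (hψ _ hunit).1 (hψ _ hunit).2 (by rw [hiso, hunit, one_pow])
      refine le_trans (measureReal_mono fun ω hω => ?_) hbern
      simp only [bad, Set.mem_ofPred_eq] at hω ⊢
      have e : (∑ i, (inner ℝ (X i ω) (‖w j‖⁻¹ • w j)) ^ 2) / (k : ℝ) - 1 =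
          (empiricalNorm (fun i => X i ω) (w j) ^ 2 - ‖w j‖ ^ 2) / ‖w j‖ ^ 2 := by
        rw [empiricalNorm, Real.sq_sqrt (by positivity)]
        simp only [inner_smul_right, mul_pow, ← Finset.mul_sum]
        field_simp
      rw [e, abs_div, abs_of_pos (show 0 < ‖w j‖ ^ 2 by positivity),
        lt_div_iff₀ (by positivity)]
      exact hω
  -- The `X i` are only a.e. measurable, so the bad event is replaced by a measurable hull of the
  -- same measure.
  refine ⟨(toMeasurable P (⋃ j, bad j))ᶜ, (measurableSet_toMeasurable _ _).compl, ?_, ?_⟩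
  · rw [probReal_compl_eq_one_sub (measurableSet_toMeasurable _ _)]
    have h1 : P.real (toMeasurable P (⋃ j, bad j)) = P.real (⋃ j, bad j) := by
      simp [Measure.real, measure_toMeasurable]
    have h2 : P.real (⋃ j, bad j) ≤ ∑ j, P.real (bad j) := measureReal_iUnion_fintype_le _
    have h3 : ∑ j, P.real (bad j) ≤
        ∑ _j : J, 2 * Real.exp (-(k * (δ ^ 2 / (32 * K ^ 4)))) :=
      Finset.sum_le_sum fun j _ => hbad j
    rw [Finset.sum_const, Finset.card_univ, nsmul_eq_mul] at h3
    rw [h1]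
    linarith
  · intro ω hω j
    by_contra hcon
    exact hω (subset_toMeasurable _ _ (Set.mem_iUnion.2 ⟨j, not_le.1 hcon⟩))

/-- The union bound for the sums of `⌈40 / ρ⌉ + 1` signed basis vectors, with
`ρ = C log (C n / k) / k`. -/
theorem two_mul_card_sym_le_exp {n k m : ℕ} (hk : 1 ≤ k) (hkn : k ≤ n) {C ρ : ℝ} (hC : 100 ≤ C)
    (hρ : ρ = C * Real.log (C * n / k) / k) (hm1 : 40 / ρ ≤ m) (hm2 : m ≤ 48 / ρ) (hm : 1 ≤ m) :
    2 * (Fintype.card (Sym (Option (Fin n × Bool)) m) : ℝ) ≤ Real.exp (96 * k / C) := by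
  have hk0 : (0 : ℝ) < k := by exact_mod_cast hk
  have hkn' : (k : ℝ) ≤ n := by exact_mod_cast hkn
  have hm0 : (0 : ℝ) < m := by exact_mod_cast hm
  have hC0 : 0 < C := by linarith
  set D : ℝ := C * n / k with hD
  have hDC : C ≤ D := by rw [hD, le_div_iff₀ hk0]; gcongr
  have hD0 : 0 < D := by linarith
  have hℓ1 : 1 ≤ Real.log D := by
    rw [Real.le_log_iff_exp_le hD0]
    linarith [Real.exp_one_lt_d9]
  have hℓD : Real.log D ≤ D := (Real.log_le_sub_one_of_pos hD0).trans (by linarith)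
  set ℓ := Real.log D with hℓ
  have hρ0 : 0 < ρ := by rw [hρ]; positivity
  have hmn : m ≤ n := by
    have : (m : ℝ) ≤ k := by
      refine hm2.trans ?_
      rw [hρ, div_div_eq_mul_div, div_le_iff₀ (by positivity)]
      have h48 : 48 ≤ C * ℓ := by nlinarith
      nlinarith
    exact_mod_cast this.trans hkn'
  have hbase : Real.exp 1 * (Real.exp 1 * (3 * n / m)) ≤ Real.exp (2 * ℓ) := by
    have h1 : (n : ℝ) / m ≤ D * ℓ / 40 := by
      rw [div_le_iff₀ hρ0] at hm1
      rw [div_le_iff₀ hm0]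
      have e : D * ℓ = n * ρ := by rw [hρ, hD]; field_simp
      rw [e]
      have := mul_le_mul_of_nonneg_left hm1 (show (0 : ℝ) ≤ n by positivity)
      linarith
    have h2 : Real.exp 1 * Real.exp 1 ≤ 9 := by
      nlinarith [Real.exp_one_lt_d9, Real.exp_pos 1]
    have h3 : Real.exp (2 * ℓ) = D * D := by
      rw [two_mul, Real.exp_add, hℓ, Real.exp_log hD0]
    rw [h3]
    calc Real.exp 1 * (Real.exp 1 * (3 * n / m)) =
          Real.exp 1 * Real.exp 1 * (3 * ((n : ℝ) / m)) := by ring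
      _ ≤ 9 * (3 * (D * ℓ / 40)) := by gcongr
      _ ≤ D * D := by nlinarith
  calc 2 * (Fintype.card (Sym (Option (Fin n × Bool)) m) : ℝ) ≤
        Real.exp 1 ^ m * (Real.exp 1 * (3 * n / m)) ^ m := by
        gcongr
        -- The factor `2` from the two Bernstein tails is absorbed into `e^m`.
        · have h2 : (2 : ℝ) ≤ Real.exp 1 := by linarith [Real.exp_one_gt_d9]
          exact h2.trans (le_self_pow₀ (by linarith) (by omega))
        · exact card_sym_signed_le hm hmn
    _ = (Real.exp 1 * (Real.exp 1 * (3 * n / m))) ^ m := (mul_pow _ _ _).symm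
    _ ≤ Real.exp (2 * ℓ) ^ m := by gcongr
    _ = Real.exp (m * (2 * ℓ)) := (Real.exp_nat_mul _ _).symm
    _ ≤ Real.exp (96 * k / C) := by
        gcongr
        calc (m : ℝ) * (2 * ℓ) ≤ 48 / ρ * (2 * ℓ) := by gcongr
          _ = 96 * k / C := by rw [hρ]; field_simp; ring

/-! ### The main theorem -/

theorem mainTheorem7 :
    ∃ cbar c : ℝ, 0 < cbar ∧ 1 ≤ c ∧
      ∀ (n k : ℕ), 1 ≤ k → k ≤ n →
      ∀ (θ : ℝ), 0 < θ → θ < 1 →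
      ∀ (α : ℝ) (μ : Measure (EuclideanSpace ℝ (Fin n))) [IsProbabilityMeasure μ],
        IsIsotropic μ → IsPsi2With μ α →
      ∀ {Ω : Type*} [MeasurableSpace Ω] (P : Measure Ω) [IsProbabilityMeasure P]
        (X : Fin k → Ω → EuclideanSpace ℝ (Fin n)),
        (∀ i, HasLaw (X i) μ P) → iIndepFun X P →
        ∃ E : Set Ω, MeasurableSet E ∧
          1 - Real.exp (-(cbar * θ ^ 2 * (k : ℝ) / α ^ 4)) ≤ P.real E ∧
          ∀ ω ∈ E, ∀ ε : ℝ, 0 < ε →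
            (∀ p : ℝ, 0 < p → p < 1 →
              ∀ v ∈ weakLpBall n p, ∀ y ∈ weakLpBall n p,
                empiricalNorm (fun i => X i ω) (v - y) ≤ ε →
                ‖y - v‖ ≤ ε / (1 - θ) +
                  (2 : ℝ) ^ (1 / p + 1) * (1 / p - 1)⁻¹ *
                    (rateTerm c α θ n k) ^ (1 / p - 1 / 2)) ∧
            (∀ v ∈ l1Ball n, ∀ y ∈ l1Ball n,
                empiricalNorm (fun i => X i ω) (v - y) ≤ ε →
                ‖y - v‖ ≤ ε / (1 - θ) + (rateTerm c α θ n k) ^ (1 / 2 : ℝ)) := by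
  refine ⟨1 / 4096, 1000000, by norm_num, by norm_num, ?_⟩
  intro n k hk hkn θ hθ hθ1 α μ _ hiso hpsi Ω _ P _ X hX hind
  have hk0 : (0 : ℝ) < k := by exact_mod_cast hk
  have hkn' : (k : ℝ) ≤ n := by exact_mod_cast hkn
  have hψ : ∀ K : ℝ, 0 < K → α < K → ∀ y : EuclideanSpace ℝ (Fin n), ‖y‖ = 1 →
      Integrable (fun x => Real.exp ((inner ℝ x y) ^ 2 / K ^ 2)) μ ∧
        ∫ x, Real.exp ((inner ℝ x y) ^ 2 / K ^ 2) ∂μ ≤ 2 := by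
    intro K hK hαK y hy
    refine integral_exp_sq_le_two_of_psi2Norm_lt (by fun_prop) ((hpsi y).trans_lt ?_)
    rw [hy, mul_one]
    exact (ENNReal.ofReal_lt_ofReal_iff hK).2 hαK
  have hK1 : ∀ K : ℝ, 0 < K → α < K → 1 ≤ K := by
    intro K hK hαK
    have hunit : ‖(EuclideanSpace.single (⟨0, by omega⟩ : Fin n) (1 : ℝ))‖ = 1 := by simp
    exact one_le_of_integral_exp_sq_le_two hK (hψ K hK hαK _ hunit).1 (hψ K hK hαK _ hunit).2
      (by rw [hiso, hunit, one_pow])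
  -- Any threshold below `1` would do: isotropy forces every positive `K > α` to be at least `1`.
  have hα : 1 / 2 ≤ α := by
    by_contra hcon
    have := hK1 (1 / 2) (by norm_num) (not_le.1 hcon)
    norm_num at this
  have hα0 : 0 < α := by linarith
  have hα4 : 1 / 16 ≤ α ^ 4 := by
    have := pow_le_pow_left₀ (by norm_num) hα 4
    norm_num at this ⊢
    exact this
  set ρ := rateTerm 1000000 α θ n k with hρdef
  set C := 1000000 * α ^ 4 / θ ^ 2 with hCdef
  have hC : 100 ≤ C := by
    rw [hCdef, le_div_iff₀ (by positivity)]
    nlinarith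
  have hC0 : 0 < C := by linarith
  have hρeq : ρ = C * Real.log (C * n / k) / k := rfl
  have hlog : 0 < Real.log (C * n / k) := by
    refine Real.log_pos ?_
    rw [lt_div_iff₀ hk0]
    nlinarith
  have hρ0 : 0 < ρ := by rw [hρeq]; positivity
  have hθ' : 0 < 1 - θ := by linarith
  rcases le_or_gt 4 ρ with hρ4 | hρ4
  · refine ⟨Set.univ, MeasurableSet.univ, ?_, ?_⟩
    · rw [probReal_univ]
      linarith [Real.exp_pos (-(1 / 4096 * θ ^ 2 * (k : ℝ) / α ^ 4))]
    · intro ω _ ε hε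
      have hε' : 0 < ε / (1 - θ) := div_pos hε hθ'
      refine ⟨fun p hp hp1 v hv y hy _ => ?_, fun v hv y hy _ => ?_⟩
      · have := norm_sub_le_of_weakLp_of_four_le hp hp1 hρ4 hv hy
        rw [norm_sub_rev]
        linarith
      · have h1 := (norm_le_sum_abs (v - y)).trans (sum_abs_sub_le_two hv hy)
        have h2 : 2 ≤ ρ ^ (1 / 2 : ℝ) := by
          rw [← Real.sqrt_eq_rpow]
          exact Real.le_sqrt_of_sq_le (by linarith)
        rw [norm_sub_rev]
        linarith
  · have hm1 : 40 / ρ ≤ (⌈40 / ρ⌉₊ : ℝ) := Nat.le_ceil _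
    have hm2 : (⌈40 / ρ⌉₊ : ℝ) + 1 ≤ 48 / ρ := by
      have h1 := (Nat.ceil_lt_add_one (show 0 ≤ 40 / ρ by positivity)).le
      have h2 : 40 / ρ + 2 ≤ 48 / ρ := by
        rw [← sub_nonneg, show 48 / ρ - (40 / ρ + 2) = 2 * (4 - ρ) / ρ by field_simp; ring]
        exact div_nonneg (by linarith) hρ0.le
      linarith
    have hm3 : 1 ≤ ⌈40 / ρ⌉₊ := Nat.ceil_pos.2 (by positivity)
    -- The `+ 1` gives `m - 1 ≥ 40/ρ = 2 L²` for `L = √(20/ρ)`.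
    set m := ⌈40 / ρ⌉₊ + 1 with hm
    have hmcast : (m : ℝ) = (⌈40 / ρ⌉₊ : ℝ) + 1 := by rw [hm]; push_cast; rfl
    obtain ⟨E, hE, hPE, hEω⟩ := exists_event_empiricalNorm hk hiso
      (hK1 (2 * α) (by linarith) (by linarith)) (hψ (2 * α) (by linarith) (by linarith)) hX hind
      (δ := θ / 2) (by linarith) (by linarith)
      (fun s : Sym (Option (Fin n × Bool)) m => ((s : Multiset _).map (signedBasis n)).sum)
    refine ⟨E, hE, le_trans ?_ hPE, ?_⟩
    · have hcard := two_mul_card_sym_le_exp (m := m) hk hkn hC hρeq (by linarith) (by linarith)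
        (by omega)
      have h1 : (Fintype.card (Sym (Option (Fin n × Bool)) m) : ℝ) *
          (2 * Real.exp (-(k * ((θ / 2) ^ 2 / (32 * (2 * α) ^ 4))))) ≤
          Real.exp (96 * k / C) * Real.exp (-(k * ((θ / 2) ^ 2 / (32 * (2 * α) ^ 4)))) := by
        rw [← mul_assoc, mul_comm _ (2 : ℝ)]
        gcongr
      -- In units of `k θ² / α⁴`: Bernstein with `δ = θ/2`, `K = 2α` yields `1/2048`, the union
      -- bound costs `96/10⁶`, and at least `1/4096` remains.
      have h2 : 96 * k / C + -(k * ((θ / 2) ^ 2 / (32 * (2 * α) ^ 4))) ≤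
          -(1 / 4096 * θ ^ 2 * (k : ℝ) / α ^ 4) := by
        have e1 : 96 * k / C = 96 / 1000000 * (k * θ ^ 2 / α ^ 4) := by
          rw [hCdef]; field_simp
        have e2 : k * ((θ / 2) ^ 2 / (32 * (2 * α) ^ 4)) = 1 / 2048 * (k * θ ^ 2 / α ^ 4) := by
          field_simp; norm_num
        have e3 : 1 / 4096 * θ ^ 2 * (k : ℝ) / α ^ 4 = 1 / 4096 * (k * θ ^ 2 / α ^ 4) := by ring
        rw [e1, e2, e3]
        have : 0 ≤ k * θ ^ 2 / α ^ 4 := by positivity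
        linarith
      rw [← Real.exp_add] at h1
      have h3 := Real.exp_le_exp.2 h2
      linarith
    · intro ω hω ε hε
      have hε' : 0 < ε / (1 - θ) := div_pos hε hθ'
      have hlower : ∀ z : EuclideanSpace ℝ (Fin n), ∑ i, |z i| ≤ √(20 / ρ) * ‖z‖ →
          (1 - θ) * ‖z‖ ≤ empiricalNorm (fun i => X i ω) z :=
        empiricalNorm_lower_bound (by omega) _ hθ hθ1 (fun s hs => hEω ω hω ⟨s, hs⟩)
          (by positivity) (by
            rw [Real.sq_sqrt (by positivity), hmcast, show 2 * (20 / ρ) = 40 / ρ by ring]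
            linarith)
      refine ⟨fun p hp hp1 v hv y hy hvy => ?_, fun v hv y hy hvy => ?_⟩
      · rw [norm_sub_rev]
        have hq : 0 < 1 / p - 1 := by rw [sub_pos, lt_div_iff₀ hp]; linarith
        have hr : 0 ≤ (2 : ℝ) ^ (1 / p + 1) * (1 / p - 1)⁻¹ * ρ ^ (1 / p - 1 / 2) := by positivity
        rcases le_or_gt ‖v - y‖ ((2 : ℝ) ^ (1 / p + 1) * (1 / p - 1)⁻¹ * ρ ^ (1 / p - 1 / 2))
          with h | h
        · linarith
        · have h1 := hlower _ (sum_abs_le_of_weakLp_of_lt_norm hp hp1 hρ0 hρ4 hv hy h)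
          have h2 : ‖v - y‖ ≤ ε / (1 - θ) := by rw [le_div_iff₀ hθ']; linarith
          linarith
      · rw [norm_sub_rev]
        have hr : 0 ≤ ρ ^ (1 / 2 : ℝ) := by positivity
        rcases le_or_gt ‖v - y‖ (ρ ^ (1 / 2 : ℝ)) with h | h
        · linarith
        · have h1 := hlower _ (sum_abs_le_of_l1_of_lt_norm hρ0 hv hy h)
          have h2 : ‖v - y‖ ≤ ε / (1 - θ) := by rw [le_div_iff₀ hθ']; linarith
          linarith
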